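/- Let $K$ be a field and $q\in K$ with $q\neq 1$ (for instance $K=\mathbb{Q}(q)$ with $q$ an indeterminate, or $q$ a real or complex number different from $1$). Put $[m]_q=\frac{1-q^m}{1-q}$, and let the $q$-tangent numbers $E_{2n+1}(q)$, $n\ge 0$, be defined by the formal power series expansion of the continued fraction $$\sum_{n=0}^{\infty} E_{2n+1}(q)\, x^n = \cfrac{1}{1-\cfrac{[1]_q[2]_q\,x}{1-\cfrac{[2]_q[3]_q\,x}{1-\cfrac{[3]_q[4]_q\,x}{\ddots}}}}\,,$$ where the continued fraction denotes the $x$-adic limit of its finite truncations. Then for every integer $n\ge 0$, $$E_{2n+1}(q)=\frac{1}{(1-q)^{2n+1}}\sum_{k=0}^{n}\left(\binom{2n+1}{n-k}-\binom{2n+1}{n-k-1}\right)\sum_{i=0}^{2k+1}(-1)^{i+k}q^{i(2k+2-i)},$$ where $\binom{m}{j}=0$ for $j<0$. -/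

import Mathlib

/-- The `q`-integer `[n]_q = (1 - q ^ n) / (1 - q)` (used for `q ≠ 1`). -/
def qInteger {K : Type*} [Field K] (q : K) (n : ℕ) : K :=
  (1 - q ^ n) / (1 - q)

/-- The finite continued fraction `1 / (1 - c₀ x / (1 - c₁ x / ( ⋯ / (1 - c_{N-1} x))))` with `N`
coefficients, as a formal power series in `x`. All denominators have constant coefficient `1`,
so that the inverse of power series is a true inverse. -/
noncomputable def stieltjesConvergent {K : Type*} [Field K] : (ℕ → K) → ℕ → PowerSeries K
  | _, 0 => 1
  | c, N + 1 =>
      (1 - PowerSeries.C (c 0) * PowerSeries.X * stieltjesConvergent (fun i => c (i + 1)) N)⁻¹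

/-- The infinite continued fraction `1 / (1 - c₀ x / (1 - c₁ x / (1 - c₂ x / ⋯)))` as a formal power
series in `x`, i.e. the `x`-adic limit of its convergents: the coefficient of `x ^ n` is the same in
all convergents with at least `n` coefficients (see `coeff_stieltjesConvergent`). -/
noncomputable def stieltjesFraction {K : Type*} [Field K] (c : ℕ → K) : PowerSeries K :=
  PowerSeries.mk fun n => PowerSeries.coeff n (stieltjesConvergent c n)

/-- Consecutive convergents agree up to the expected order. -/
theorem stieltjesConvergent_succ_sub {K : Type*} [Field K] (N : ℕ) (c : ℕ → K) :
    (PowerSeries.X : PowerSeries K) ^ (N + 1) ∣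
      stieltjesConvergent c (N + 1) - stieltjesConvergent c N := by
  induction N generalizing c with
  | zero =>
    rw [zero_add, pow_one, PowerSeries.X_dvd_iff]
    simp [stieltjesConvergent]
  | succ N ih =>
    obtain ⟨d, hd⟩ := ih (fun i => c (i + 1))
    rw [stieltjesConvergent.eq_2 c (N + 1), stieltjesConvergent.eq_2 c N]
    set A := stieltjesConvergent (fun i => c (i + 1)) (N + 1)
    set B := stieltjesConvergent (fun i => c (i + 1)) N
    have hA := PowerSeries.mul_inv_cancel
      (1 - PowerSeries.C (c 0) * PowerSeries.X * A) (by simp)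
    have hB := PowerSeries.mul_inv_cancel
      (1 - PowerSeries.C (c 0) * PowerSeries.X * B) (by simp)
    set a := (1 - PowerSeries.C (c 0) * PowerSeries.X * A)⁻¹
    set b := (1 - PowerSeries.C (c 0) * PowerSeries.X * B)⁻¹
    refine ⟨PowerSeries.C (c 0) * a * b * d, ?_⟩
    linear_combination
      PowerSeries.C (c 0) * PowerSeries.X * a * b * hd - a * hB + b * hA

/-- The coefficient of `x ^ n` in the infinite continued fraction is its coefficient in every
convergent with at least `n` coefficients. -/
theorem coeff_stieltjesConvergent {K : Type*} [Field K] (c : ℕ → K) {n N : ℕ} (h : n ≤ N) :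
    PowerSeries.coeff n (stieltjesConvergent c N) =
      PowerSeries.coeff n (stieltjesFraction c) := by
  rw [stieltjesFraction, PowerSeries.coeff_mk]
  induction N, h using Nat.le_induction with
  | base => rfl
  | succ N hN ih =>
    rw [← ih]
    have h1 := PowerSeries.X_pow_dvd_iff.mp (stieltjesConvergent_succ_sub N c) n (by omega)
    rw [map_sub] at h1
    exact sub_eq_zero.mp h1

/-- The `q`-tangent number `E_{2n+1}(q)`: the coefficient of `x ^ n` in the continued fraction
`1 / (1 - [1]_q [2]_q x / (1 - [2]_q [3]_q x / (1 - [3]_q [4]_q x / ⋯)))`. -/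
noncomputable def qTangentNumber {K : Type*} [Field K] (q : K) (n : ℕ) : K :=
  PowerSeries.coeff n (stieltjesFraction fun h => qInteger q (h + 1) * qInteger q (h + 2))

/-- The binomial coefficient with integer lower index, zero when that index is negative. -/
def binomInt (m : ℕ) (j : ℤ) : ℤ :=
  if 0 ≤ j then (m.choose j.toNat : ℤ) else 0

/-! Up to the factor (1-q)^(2n), the coefficient of x^n is the moment Λ(X^(2n)), where Λ(f) is the
(0,0) entry of f(J) and J is the Jacobi operator with weights (1-q^(h+1))(1-q^(h+2)). The goal is to
evaluate L(X^(2n+1)), where L(f) = (1-q) Λ(f/X).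

The bridge is the q-Hermite family H_m. The vectors H_m(J)e₀ have closed-form entries, so Λ(H_(2k))
is known, and the Hermite recurrence gives L(H_(2k+1)) = (-1)^k (1-q)(1-q^3)⋯(1-q^(2k+1)). On the
other hand, H_(2k+1) is a unitriangular combination, with Gaussian binomial coefficients, of
differences S_(2m+1) - S_(2m-1) of Chebyshev polynomials. The theta sums satisfy the same triangular
system (`sum_gaussBinom_mul_alternatingTheta`), so L(S_(2m-1)) is the m-th theta sum.

The same expansion with Hermite parameter 1, where H_m = X^m, writes X^(2n+1) in the S_(2m-1) with
ordinary binomials. Applying L and summing by parts gives the formula. -/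

/-- The Gaussian binomial coefficient, defined by the `q`-Pascal rule. -/
def gaussBinom {K : Type*} [Field K] (q : K) : ℕ → ℕ → K
  | _, 0 => 1
  | 0, _ + 1 => 0
  | n + 1, j + 1 => gaussBinom q n j + q ^ (j + 1) * gaussBinom q n (j + 1)

/-- The product `(1 - q) (1 - q ^ 3) ⋯ (1 - q ^ (2 k - 1))`. -/
def oddPochhammer {K : Type*} [Field K] (q : K) (k : ℕ) : K :=
  ∏ i ∈ Finset.range k, (1 - q ^ (2 * i + 1))

/-! ### Gaussian binomials and Gauss's alternating sum. -/

section GaussBinom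

variable {K : Type*} [Field K] (q : K)

theorem gaussBinom_zero_right (n : ℕ) : gaussBinom q n 0 = 1 := by
  cases n <;> simp [gaussBinom]

theorem gaussBinom_succ_succ (n j : ℕ) :
    gaussBinom q (n + 1) (j + 1) = gaussBinom q n j + q ^ (j + 1) * gaussBinom q n (j + 1) := by
  rw [gaussBinom]

theorem gaussBinom_eq_zero {n j : ℕ} (h : n < j) : gaussBinom q n j = 0 := by
  induction n generalizing j with
  | zero => obtain ⟨j, rfl⟩ := Nat.exists_eq_succ_of_ne_zero h.ne'; rw [Nat.succ_eq_add_one, gaussBinom]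
  | succ n ih =>
    obtain ⟨j, rfl⟩ := Nat.exists_eq_succ_of_ne_zero (Nat.ne_zero_of_lt h)
    rw [Nat.succ_eq_add_one, gaussBinom_succ_succ, ih (by omega), ih (by omega)]
    ring

theorem gaussBinom_self (n : ℕ) : gaussBinom q n n = 1 := by
  induction n with
  | zero => rw [gaussBinom]
  | succ n ih => rw [gaussBinom_succ_succ, ih, gaussBinom_eq_zero q n.lt_succ_self]; ring

/-- The second `q`-Pascal rule. -/
theorem gaussBinom_add_succ_succ (i j : ℕ) :
    gaussBinom q (i + j + 1) (j + 1) =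
      q ^ i * gaussBinom q (i + j) j + gaussBinom q (i + j) (j + 1) := by
  induction i generalizing j with
  | zero => simp [gaussBinom_self, gaussBinom_eq_zero]
  | succ i ih =>
    induction j with
    | zero =>
      have := ih 0
      simp only [add_zero, zero_add, gaussBinom_zero_right, gaussBinom_succ_succ, pow_one] at this ⊢
      linear_combination q * this
    | succ j ihj =>
      have h1 := ih (j + 1)
      have e1 : i + 1 + j + 1 = i + (j + 1) + 1 := by ring
      have e2 : i + 1 + (j + 1) = i + (j + 1) + 1 := by ring
      rw [e1] at ihj
      have e3 : i + 1 + j = i + (j + 1) := by ring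
      rw [e3] at ihj
      rw [e2, gaussBinom_succ_succ q (i + (j + 1) + 1), gaussBinom_succ_succ q (i + (j + 1)) (j + 1)]
      rw [gaussBinom_succ_succ q (i + (j + 1)) j] at ihj ⊢
      linear_combination ihj + q ^ (j + 2) * h1 -
        q ^ (j + 2) * gaussBinom_succ_succ q (i + (j + 1)) (j + 1)

theorem gaussBinom_symm_add (i j : ℕ) : gaussBinom q (i + j) i = gaussBinom q (i + j) j := by
  induction i generalizing j with
  | zero => simp [gaussBinom_self, gaussBinom_zero_right]
  | succ i ih =>
    induction j with
    | zero => simp [gaussBinom_self, gaussBinom_zero_right]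
    | succ j ihj =>
      have h1 := ih (j + 1)
      have e1 : i + 1 + j = i + (j + 1) := by ring
      have e2 : i + 1 + (j + 1) = i + (j + 1) + 1 := by ring
      have h2 := gaussBinom_add_succ_succ q (i + 1) j
      rw [e1] at ihj h2
      rw [e2, h2, gaussBinom_succ_succ, h1, ihj]
      ring

theorem gaussBinom_symm {n j : ℕ} (h : j ≤ n) : gaussBinom q n (n - j) = gaussBinom q n j := by
  obtain ⟨i, rfl⟩ := Nat.exists_eq_add_of_le' h
  rw [Nat.add_sub_cancel, gaussBinom_symm_add]

/-- The absorption identity. -/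
theorem one_sub_pow_mul_gaussBinom (n j : ℕ) :
    (1 - q ^ (j + 1)) * gaussBinom q (n + 1) (j + 1) = (1 - q ^ (n + 1)) * gaussBinom q n j := by
  induction n generalizing j with
  | zero =>
    cases j with
    | zero => simp [gaussBinom]
    | succ j => rw [gaussBinom_eq_zero q (by omega), gaussBinom_eq_zero q (by omega)]; ring
  | succ n ih =>
    cases j with
    | zero =>
      have := ih 0
      rw [gaussBinom_succ_succ]
      simp only [gaussBinom_zero_right] at this ⊢
      linear_combination q * this
    | succ j =>
      rw [gaussBinom_succ_succ q (n + 1)]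
      linear_combination q ^ (j + 2) * ih (j + 1) + q * ih j -
        q * (1 - q ^ (n + 1)) * gaussBinom_succ_succ q n j

theorem one_sub_pow_mul_gaussBinom_add (i j : ℕ) :
    (1 - q ^ (j + 1)) * gaussBinom q (i + j + 1) (j + 1) =
      (1 - q ^ (i + 1)) * gaussBinom q (i + j + 1) j := by
  have h := one_sub_pow_mul_gaussBinom q (i + j) i
  have h2 : gaussBinom q (i + j + 1) (i + 1) = gaussBinom q (i + j + 1) j := by
    have := gaussBinom_symm_add q (i + 1) j
    rwa [add_right_comm] at this
  rw [one_sub_pow_mul_gaussBinom, ← gaussBinom_symm_add, ← h2, h]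

theorem gaussBinom_one (n j : ℕ) : gaussBinom (1 : K) n j = n.choose j := by
  induction n generalizing j with
  | zero => cases j <;> simp [gaussBinom]
  | succ n ih =>
    cases j with
    | zero => simp [gaussBinom]
    | succ j => simp [gaussBinom, ih, Nat.choose_succ_succ]

theorem oddPochhammer_succ (k : ℕ) :
    oddPochhammer q (k + 1) = oddPochhammer q k * (1 - q ^ (2 * k + 1)) :=
  Finset.prod_range_succ _ _

/-- The Pascal rule summed against alternating signs. -/
theorem sum_alternating_gaussBinom_mul_pow (n : ℕ) :
    ∑ j ∈ Finset.range (n + 1), (-1) ^ j * gaussBinom q n j * q ^ j =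
      (∑ j ∈ Finset.range (n + 2), (-1) ^ j * gaussBinom q (n + 1) j) +
        ∑ j ∈ Finset.range (n + 1), (-1) ^ j * gaussBinom q n j := by
  have h1 : ∑ j ∈ Finset.range (n + 1), (-1) ^ j * gaussBinom q n j * q ^ j =
      1 + ∑ j ∈ Finset.range (n + 1),
        (-1) ^ (j + 1) * gaussBinom q n (j + 1) * q ^ (j + 1) := by
    have e := Finset.sum_range_succ (fun j => (-1) ^ j * gaussBinom q n j * q ^ j) (n + 1)
    rw [Finset.sum_range_succ', gaussBinom_eq_zero q n.lt_succ_self] at e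
    simpa [gaussBinom_zero_right, add_comm] using e.symm
  rw [h1, Finset.sum_range_succ' _ (n + 1), gaussBinom_zero_right, add_right_comm,
    ← Finset.sum_add_distrib, add_comm]
  congr 1
  · exact Finset.sum_congr rfl fun j _ => by rw [gaussBinom_succ_succ]; ring
  · simp

/-- Absorption turns the sum weighted by 1 - q^j into a multiple of the alternating sum one level
lower; the preceding identity eliminates the part weighted by q^j. -/
theorem sum_alternating_gaussBinom_succ_succ (n : ℕ) :
    ∑ j ∈ Finset.range (n + 3), (-1) ^ j * gaussBinom q (n + 2) j =
      (1 - q ^ (n + 1)) * ∑ j ∈ Finset.range (n + 1), (-1) ^ j * gaussBinom q n j := by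
  have h := sum_alternating_gaussBinom_mul_pow q (n + 1)
  have h2 : ∑ j ∈ Finset.range (n + 2), (-1) ^ j * gaussBinom q (n + 1) j -
      ∑ j ∈ Finset.range (n + 2), (-1) ^ j * gaussBinom q (n + 1) j * q ^ j =
      -((1 - q ^ (n + 1)) * ∑ j ∈ Finset.range (n + 1), (-1) ^ j * gaussBinom q n j) := by
    rw [← Finset.sum_sub_distrib, Finset.sum_range_succ', Finset.mul_sum, ← Finset.sum_neg_distrib]
    simp only [pow_zero, mul_one, sub_self, add_zero]
    refine Finset.sum_congr rfl fun j _ => ?_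
    linear_combination (-1) ^ (j + 1) * one_sub_pow_mul_gaussBinom q n j
  linear_combination -h - h2

/-- Gauss's evaluation of the alternating sum of Gaussian binomial coefficients. -/
theorem sum_alternating_gaussBinom (k : ℕ) :
    (∑ j ∈ Finset.range (2 * k + 1), (-1) ^ j * gaussBinom q (2 * k) j = oddPochhammer q k) ∧
      ∑ j ∈ Finset.range (2 * k + 2), (-1) ^ j * gaussBinom q (2 * k + 1) j = 0 := by
  induction k with
  | zero => simp [Finset.sum_range_succ, gaussBinom, oddPochhammer]
  | succ k ih =>
    constructor
    · rw [show 2 * (k + 1) = 2 * k + 2 by ring, sum_alternating_gaussBinom_succ_succ, ih.1,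
        oddPochhammer_succ]
      ring
    · rw [show 2 * (k + 1) = 2 * k + 2 by ring, sum_alternating_gaussBinom_succ_succ, ih.2, mul_zero]

end GaussBinom

/-- A sum over a range of even length folds onto its first half. -/
theorem sum_range_fold {M : Type*} [AddCommMonoid M] (f : ℕ → M) (k : ℕ) :
    ∑ j ∈ Finset.range (2 * k + 2), f j =
      ∑ j ∈ Finset.range (k + 1), (f j + f (2 * k + 1 - j)) := by
  rw [show 2 * k + 2 = (k + 1) + (k + 1) by ring, Finset.sum_range_add, Finset.sum_add_distrib]
  congr 1
  rw [← Finset.sum_range_reflect]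
  refine Finset.sum_congr rfl fun j hj => ?_
  congr 1
  have := Finset.mem_range.mp hj
  omega

/-- The alternating sum `-(-1) ^ m ∑ (-1) ^ i q ^ (i (2 m - i))` over `0 ≤ i < 2 m`. -/
def alternatingTheta {K : Type*} [Field K] (q : K) (m : ℕ) : K :=
  ∑ i ∈ Finset.range (2 * m), (-1) ^ (i + m + 1) * q ^ (i * (2 * m - i))

/-! ### Theta sums and their triangular system. -/

section Theta

variable {K : Type*} [Field K] (q : K)

theorem alternatingTheta_zero : alternatingTheta q 0 = 0 := by simp [alternatingTheta]

/-- Since (i+1)(2m+1-i) = i(2m-i) + (2m+1), the inner terms reproduce the previous sum; the two end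
terms give the inhomogeneous part. -/
theorem alternatingTheta_succ (m : ℕ) :
    alternatingTheta q (m + 1) =
      q ^ (2 * m + 1) * alternatingTheta q m + (-1) ^ m * (1 - q ^ (2 * m + 1)) := by
  unfold alternatingTheta
  rw [show 2 * (m + 1) = 2 * m + 1 + 1 by ring, Finset.sum_range_succ, Finset.sum_range_succ']
  have h : ∑ i ∈ Finset.range (2 * m), (-1 : K) ^ (i + 1 + (m + 1) + 1) *
      q ^ ((i + 1) * (2 * m + 1 + 1 - (i + 1))) =
      q ^ (2 * m + 1) * ∑ i ∈ Finset.range (2 * m), (-1) ^ (i + m + 1) * q ^ (i * (2 * m - i)) := by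
    rw [Finset.mul_sum]
    refine Finset.sum_congr rfl fun i hi => ?_
    obtain ⟨d, hd⟩ := Nat.exists_eq_add_of_lt (Finset.mem_range.mp hi)
    rw [show 2 * m + 1 + 1 - (i + 1) = d + 2 by omega, show 2 * m - i = d + 1 by omega, hd]
    ring
  rw [h, show 2 * m + 1 + 1 - (2 * m + 1) = 1 by omega]
  have e : (-1 : K) ^ (2 * m) = 1 := by simp
  simp only [zero_mul, pow_zero, mul_one]
  linear_combination -(q ^ (2 * m + 1) * (-1) ^ m) * e

theorem sum_gaussBinom_mul_alternatingTheta (k : ℕ) :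
    ∑ j ∈ Finset.range (k + 1), gaussBinom q (2 * k + 1) j *
        (alternatingTheta q (k - j + 1) - alternatingTheta q (k - j)) =
      (-1) ^ k * oddPochhammer q (k + 1) := by
  -- The inhomogeneous part of the theta recurrence: a folded form of Gauss's sum, since j ↦ 2k+1-j
  -- reverses the sign.
  have hB : ∑ j ∈ Finset.range (k + 1), (-1) ^ j * gaussBinom q (2 * k + 1) j *
      (q ^ j - q ^ (2 * k + 1 - j)) = oddPochhammer q (k + 1) := by
    have h1 := sum_alternating_gaussBinom_mul_pow q (2 * k + 1)
    have h2 := (sum_alternating_gaussBinom q (k + 1)).1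
    rw [(sum_alternating_gaussBinom q k).2, add_zero] at h1
    rw [← h2, show 2 * (k + 1) = 2 * k + 1 + 1 by ring, ← h1, sum_range_fold]
    refine Finset.sum_congr rfl fun j hj => ?_
    have hj : j ≤ k := Nat.lt_succ_iff.mp (Finset.mem_range.mp hj)
    rw [gaussBinom_symm q (by omega)]
    have hs : (-1 : K) ^ (2 * k + 1 - j) = -(-1) ^ j := by
      obtain ⟨d, rfl⟩ := Nat.exists_eq_add_of_le hj
      rw [show 2 * (j + d) + 1 - j = 2 * d + 1 + j by omega, pow_add, pow_succ, pow_mul]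
      simp
    rw [hs]
    ring
  -- The remaining part telescopes, because [2k+1, j+1](1-q^(j+1)) = [2k+1, j](1-q^(2k+1-j)).
  have hT : ∑ j ∈ Finset.range (k + 1), gaussBinom q (2 * k + 1) j *
      ((1 - q ^ j) * alternatingTheta q (k - j + 1) -
        (1 - q ^ (2 * k + 1 - j)) * alternatingTheta q (k - j)) = 0 := by
    let f : ℕ → K := fun j => gaussBinom q (2 * k + 1) j * (1 - q ^ j) *
      alternatingTheta q (k + 1 - j)
    have hf : ∑ j ∈ Finset.range (k + 1), (f j - f (j + 1)) = 0 := by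
      rw [Finset.sum_range_sub']
      simp [f, alternatingTheta_zero]
    rw [← hf]
    refine Finset.sum_congr rfl fun j hj => ?_
    have hj : j ≤ k := Nat.lt_succ_iff.mp (Finset.mem_range.mp hj)
    obtain ⟨d, rfl⟩ := Nat.exists_eq_add_of_le hj
    have h3 := one_sub_pow_mul_gaussBinom_add q (j + 2 * d) j
    rw [show j + 2 * d + j + 1 = 2 * (j + d) + 1 by ring] at h3
    simp only [f]
    rw [show j + d - j + 1 = d + 1 by omega, show j + d - j = d by omega,
      show j + d + 1 - j = d + 1 by omega, show j + d + 1 - (j + 1) = d by omega,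
      show 2 * (j + d) + 1 - j = j + 2 * d + 1 by omega]
    linear_combination alternatingTheta q d * h3
  rw [← hB, Finset.mul_sum, ← add_zero (∑ j ∈ _, (-1) ^ k * _), ← hT, ← Finset.sum_add_distrib]
  refine Finset.sum_congr rfl fun j hj => ?_
  have hj : j ≤ k := Nat.lt_succ_iff.mp (Finset.mem_range.mp hj)
  obtain ⟨d, rfl⟩ := Nat.exists_eq_add_of_le hj
  rw [show j + d - j = d by omega, show 2 * (j + d) + 1 - j = j + 2 * d + 1 by omega]
  have e : (-1 : K) ^ (j + d) * (-1) ^ j = (-1) ^ d := by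
    rw [pow_add, mul_right_comm, ← pow_add, ← two_mul, pow_mul]
    simp
  linear_combination gaussBinom q (2 * (j + d) + 1) j * q ^ j * alternatingTheta_succ q d
    - gaussBinom q (2 * (j + d) + 1) j * (q ^ j - q ^ (j + 2 * d + 1)) * e

end Theta

/-! ### Continued fractions and moments. -/

section Stieltjes

variable {K : Type*} [Field K]

/-- Formally G 1 / G 0 = 1 / (1 - c₀ x G 2 / G 1). Iterating and replacing the tail ratio at depth N
by 1 costs only order x^(N+1). -/
theorem X_pow_dvd_sub_mul_stieltjesConvergent (N : ℕ) (c : ℕ → K) (G : ℕ → PowerSeries K)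
    (hG : ∀ h, G (h + 1) = G h + PowerSeries.C (c h) * PowerSeries.X * G (h + 2)) :
    (PowerSeries.X : PowerSeries K) ^ (N + 1) ∣ G 1 - G 0 * stieltjesConvergent c N := by
  induction N generalizing c G with
  | zero =>
    refine ⟨PowerSeries.C (c 0) * G 2, ?_⟩
    rw [stieltjesConvergent, hG 0]
    ring
  | succ N ih =>
    obtain ⟨d, hd⟩ := ih (fun i => c (i + 1)) (fun i => G (i + 1)) (fun h => hG (h + 1))
    rw [stieltjesConvergent]
    set A := stieltjesConvergent (fun i => c (i + 1)) N
    have hA := PowerSeries.mul_inv_cancel (1 - PowerSeries.C (c 0) * PowerSeries.X * A) (by simp)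
    set a := (1 - PowerSeries.C (c 0) * PowerSeries.X * A)⁻¹
    refine ⟨PowerSeries.C (c 0) * a * d, ?_⟩
    have h0 := hG 0
    simp only [zero_add] at h0 hd
    linear_combination PowerSeries.C (c 0) * PowerSeries.X * a * hd - G 1 * hA + a * h0

/-- A solution of the three-term recurrence of a continued fraction evaluates that fraction. -/
theorem coeff_stieltjesFraction_eq (c : ℕ → K) (G : ℕ → PowerSeries K) (h0 : G 0 = 1)
    (hG : ∀ h, G (h + 1) = G h + PowerSeries.C (c h) * PowerSeries.X * G (h + 2)) (n : ℕ) :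
    PowerSeries.coeff n (stieltjesFraction c) = PowerSeries.coeff n (G 1) := by
  have h := PowerSeries.X_pow_dvd_iff.mp (X_pow_dvd_sub_mul_stieltjesConvergent n c G hG) n
    n.lt_succ_self
  rw [h0, one_mul, map_sub, coeff_stieltjesConvergent c le_rfl] at h
  exact (sub_eq_zero.mp h).symm

/-- The tridiagonal operator with ones on the subdiagonal, zero diagonal and superdiagonal `c`. -/
def jacobiOperator (c : ℕ → K) : Module.End K (ℕ → K) where
  toFun v
    | 0 => c 0 * v 1
    | h + 1 => v h + c (h + 1) * v (h + 2)
  map_add' v w := by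
    funext h
    cases h <;> simp only [Pi.add_apply] <;> ring
  map_smul' a v := by
    funext h
    cases h <;> simp only [Pi.smul_apply, smul_eq_mul, RingHom.id_apply] <;> ring

theorem jacobiOperator_apply_zero (c : ℕ → K) (v : ℕ → K) :
    jacobiOperator c v 0 = c 0 * v 1 := rfl

theorem jacobiOperator_apply_succ (c : ℕ → K) (v : ℕ → K) (h : ℕ) :
    jacobiOperator c v (h + 1) = v h + c (h + 1) * v (h + 2) := rfl

theorem jacobiOperator_pow_apply_eq_zero (c : ℕ → K) {n h : ℕ} (hn : n < h) :
    (jacobiOperator c ^ n) (Pi.single 0 1) h = 0 := by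
  induction n generalizing h with
  | zero => simp [hn.ne']
  | succ n ih =>
    obtain ⟨h, rfl⟩ := Nat.exists_eq_succ_of_ne_zero (Nat.ne_zero_of_lt hn)
    rw [pow_succ', Module.End.mul_apply, Nat.succ_eq_add_one, jacobiOperator_apply_succ,
      ih (by omega), ih (by omega)]
    ring

theorem jacobiOperator_pow_self_apply (c : ℕ → K) (n : ℕ) :
    (jacobiOperator c ^ n) (Pi.single 0 1) n = 1 := by
  induction n with
  | zero => simp
  | succ n ih =>
    rw [pow_succ', Module.End.mul_apply, jacobiOperator_apply_succ, ih,
      jacobiOperator_pow_apply_eq_zero c (by omega)]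
    ring

/-- The coefficients of a Stieltjes continued fraction are the even moments of the
associated Jacobi operator. -/
theorem coeff_stieltjesFraction_smul (c : ℕ → K) (r : K) (n : ℕ) :
    PowerSeries.coeff n (stieltjesFraction fun h => r * c h) =
      r ^ n * (jacobiOperator c ^ (2 * n)) (Pi.single 0 1) 0 := by
  let P : ℕ → ℕ → K := fun n h => (jacobiOperator c ^ n) (Pi.single 0 1) h
  let G : ℕ → PowerSeries K
    | 0 => 1
    | h + 1 => PowerSeries.mk fun n => r ^ n * P (2 * n + h) h
  have hP0 : ∀ n, P (n + 1) 0 = c 0 * P n 1 := fun n => by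
    simp only [P]
    rw [pow_succ', Module.End.mul_apply, jacobiOperator_apply_zero]
  have hP : ∀ n h, P (n + 1) (h + 1) = P n h + c (h + 1) * P n (h + 2) := fun n h => by
    simp only [P]
    rw [pow_succ', Module.End.mul_apply, jacobiOperator_apply_succ]
  rw [coeff_stieltjesFraction_eq _ G rfl]
  · simp [G, P]
  · intro h
    ext n
    rw [map_add, mul_assoc, PowerSeries.coeff_C_mul]
    cases n with
    | zero =>
      rw [PowerSeries.coeff_zero_X_mul]
      cases h with
      | zero => simp [G, P]
      | succ h =>
        simp only [G, PowerSeries.coeff_mk, P, mul_zero, zero_add]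
        rw [jacobiOperator_pow_self_apply, jacobiOperator_pow_self_apply]
        ring
    | succ n =>
      rw [PowerSeries.coeff_succ_X_mul]
      cases h with
      | zero =>
        simp only [G, PowerSeries.coeff_mk, PowerSeries.coeff_one, Nat.succ_ne_zero, if_false]
        have e := hP0 (2 * n + 1)
        rw [show 2 * (n + 1) + 0 = 2 * n + 1 + 1 by ring, e]
        ring
      | succ h =>
        simp only [G, PowerSeries.coeff_mk]
        have e := hP (2 * (n + 1) + h) h
        rw [← add_assoc, e, show 2 * (n + 1) + h = 2 * n + (h + 2) by ring]
        simp only [← add_assoc]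
        ring

end Stieltjes

open Polynomial in
/-- The continuous `q`-Hermite polynomials, normalized to be monic in `X = s + s⁻¹`. -/
noncomputable def qHermite {K : Type*} [Field K] (q : K) : ℕ → K[X]
  | 0 => 1
  | 1 => X
  | n + 2 => X * qHermite q (n + 1) - C (1 - q ^ (n + 1)) * qHermite q n

/-! ### q-Hermite polynomials, Chebyshev expansion and the moment functional. -/

section Hermite

open Polynomial

variable {K : Type*} [Field K] (q : K)

theorem qHermite_one_eq_X_pow (n : ℕ) : qHermite (1 : K) n = X ^ n := by
  induction n using Nat.twoStepInduction with
  | zero => simp [qHermite]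
  | one => simp [qHermite]
  | more n _ ih => rw [qHermite, ih]; simp [pow_succ']

theorem X_mul_sum_gaussBinom_mul_S (n : ℕ) :
    X * ∑ j ∈ Finset.range (n + 1), C (gaussBinom q n j) * Chebyshev.S K ((n : ℤ) - 2 * j) =
      ∑ j ∈ Finset.range (n + 1), C (gaussBinom q n j) * Chebyshev.S K ((n : ℤ) + 1 - 2 * j) +
      ∑ j ∈ Finset.range (n + 1), C (gaussBinom q n j) * Chebyshev.S K ((n : ℤ) - 1 - 2 * j) := by
  rw [Finset.mul_sum, ← Finset.sum_add_distrib]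
  refine Finset.sum_congr rfl fun j _ => ?_
  have h := Chebyshev.S_add_one K ((n : ℤ) - 2 * j)
  rw [show (n : ℤ) - 2 * j + 1 = n + 1 - 2 * j by ring,
    show (n : ℤ) - 2 * j - 1 = n - 1 - 2 * j by ring] at h
  linear_combination -C (gaussBinom q n j) * h

/-- The expansion of the `q`-Hermite polynomials in Chebyshev polynomials. -/
theorem qHermite_eq_sum (n : ℕ) :
    qHermite q n =
      ∑ j ∈ Finset.range (n + 1), C (gaussBinom q n j) * Chebyshev.S K ((n : ℤ) - 2 * j) := by
  induction n using Nat.twoStepInduction with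
  | zero => simp [qHermite, gaussBinom]
  | one => simp [qHermite, gaussBinom, Finset.sum_range_succ]
  | more n ih0 ih1 =>
    rw [qHermite, ih1, ih0, X_mul_sum_gaussBinom_mul_S]
    have e0 : ((n + 1 : ℕ) : ℤ) + 1 = n + 2 := by push_cast; ring
    have e1 : ((n + 1 : ℕ) : ℤ) - 1 = n := by push_cast; ring
    have e2 : ((n + 2 : ℕ) : ℤ) = n + 2 := by push_cast; ring
    rw [e0, e1, e2]
    -- Vanishing top terms are appended to align the summation ranges.
    have hs := Finset.sum_range_succ
      (fun j : ℕ => C (gaussBinom q (n + 1) j) * Chebyshev.S K ((n : ℤ) + 2 - 2 * j)) (n + 2)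
    rw [gaussBinom_eq_zero q (Nat.lt_succ_self _), C_0, zero_mul, add_zero,
      Finset.sum_range_succ'] at hs
    have hm := Finset.sum_range_succ
      (fun j : ℕ => C (gaussBinom q n j) * Chebyshev.S K ((n : ℤ) - 2 * j)) (n + 1)
    rw [gaussBinom_eq_zero q (Nat.lt_succ_self _), C_0, zero_mul, add_zero] at hm
    rw [← hs, ← hm, Finset.sum_range_succ' _ (n + 2), gaussBinom_zero_right, gaussBinom_zero_right,
      Finset.mul_sum, add_right_comm, add_sub_right_comm, ← Finset.sum_add_distrib,
      ← Finset.sum_sub_distrib]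
    congr 1
    refine Finset.sum_congr rfl fun j _ => ?_
    have h1 := gaussBinom_succ_succ q (n + 1) j
    have h2 := one_sub_pow_mul_gaussBinom q n j
    rw [show (n : ℤ) + 2 - 2 * ((j + 1 : ℕ) : ℤ) = n - 2 * j by push_cast; ring]
    have h3 : gaussBinom q (n + 1) (j + 1) + gaussBinom q (n + 1) j -
        (1 - q ^ (n + 1)) * gaussBinom q n j = gaussBinom q (n + 2) (j + 1) := by
      linear_combination -h1 + h2
    rw [← h3]
    simp only [map_sub, map_add, map_mul]
    ring

/-- The folded form of the Chebyshev expansion of odd `q`-Hermite polynomials. -/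
theorem qHermite_odd_eq_sum (k : ℕ) :
    qHermite q (2 * k + 1) =
      ∑ j ∈ Finset.range (k + 1), C (gaussBinom q (2 * k + 1) j) *
        (Chebyshev.S K (2 * ((k - j + 1 : ℕ) : ℤ) - 1) -
          Chebyshev.S K (2 * ((k - j : ℕ) : ℤ) - 1)) := by
  rw [qHermite_eq_sum, show 2 * k + 1 + 1 = 2 * k + 2 by ring, sum_range_fold]
  refine Finset.sum_congr rfl fun j hj => ?_
  have hj : j ≤ k := Nat.lt_succ_iff.mp (Finset.mem_range.mp hj)
  rw [gaussBinom_symm q (by omega)]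
  have h := Chebyshev.S_neg_sub_two K (2 * ((k - j : ℕ) : ℤ) - 1)
  rw [show ((2 * k + 1 : ℕ) : ℤ) - 2 * ((2 * k + 1 - j : ℕ) : ℤ) =
      -(2 * ((k - j : ℕ) : ℤ) - 1) - 2 by omega, h,
    show ((2 * k + 1 : ℕ) : ℤ) - 2 * j = 2 * ((k - j + 1 : ℕ) : ℤ) - 1 by omega]
  ring

/-- The superdiagonal of the Jacobi operator of the rescaled `q`-tangent fraction. -/
def tangentWeight (h : ℕ) : K := (1 - q ^ (h + 1)) * (1 - q ^ (h + 2))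

/-- The Hermite recurrence for the entry at height m - 2j of H_(m+2)(J)e₀, with the closed form
inserted. -/
theorem oddPochhammer_tangent_rec (m j : ℕ) (hj : 2 * j ≤ m) :
    (-1) ^ (j + 1) * q ^ (2 * (j + 1)) * gaussBinom q (m + 2) (2 * (j + 1)) *
        oddPochhammer q (j + 1) =
      (-1) ^ (j + 1) * q ^ (2 * (j + 1)) * gaussBinom q (m + 1) (2 * (j + 1)) *
        oddPochhammer q (j + 1) +
      (1 - q ^ (m - 2 * j + 1)) * (1 - q ^ (m - 2 * j + 2)) *
        ((-1) ^ j * q ^ (2 * j) * gaussBinom q (m + 1) (2 * j) * oddPochhammer q j) -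
      (1 - q ^ (m + 1)) * ((-1) ^ j * q ^ (2 * j) * gaussBinom q m (2 * j) *
        oddPochhammer q j) := by
  obtain ⟨i, rfl⟩ := Nat.exists_eq_add_of_le' hj
  have h1 := one_sub_pow_mul_gaussBinom_add q i (2 * j)
  have h2 := one_sub_pow_mul_gaussBinom q (i + 2 * j) (2 * j)
  have h3 := gaussBinom_add_succ_succ q i (2 * j + 1)
  rw [Nat.add_sub_cancel, oddPochhammer_succ, show 2 * (j + 1) = 2 * j + 1 + 1 by ring]
  rw [show i + (2 * j + 1) = i + 2 * j + 1 by ring] at h3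
  rw [show i + 2 * j + 2 = i + 2 * j + 1 + 1 by ring, h3]
  linear_combination (-1) ^ j * q ^ (2 * j) * oddPochhammer q j *
    ((1 - q ^ (i + 2)) * h1 - h2)

/-- The vectors obtained by applying the `q`-Hermite polynomials of the Jacobi operator to
the first basis vector. -/
theorem aeval_jacobiOperator_qHermite (m : ℕ) :
    (∀ h, m < h → aeval (jacobiOperator (tangentWeight q)) (qHermite q m) (Pi.single 0 1) h = 0) ∧
    ∀ h j, m = h + 2 * j →
      aeval (jacobiOperator (tangentWeight q)) (qHermite q m) (Pi.single 0 1) h =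
        (-1) ^ j * q ^ (2 * j) * gaussBinom q m (2 * j) * oddPochhammer q j := by
  induction m using Nat.twoStepInduction with
  | zero =>
    constructor
    · intro h hh
      simp [qHermite, hh.ne']
    · intro h j hj
      obtain ⟨rfl, rfl⟩ : h = 0 ∧ j = 0 := by omega
      simp [qHermite, gaussBinom, oddPochhammer]
  | one =>
    constructor
    · intro h hh
      obtain ⟨h, rfl⟩ : ∃ i, h = i + 2 := ⟨h - 2, by omega⟩
      simp [qHermite, jacobiOperator_apply_succ]
    · intro h j hj
      obtain ⟨rfl, rfl⟩ : h = 1 ∧ j = 0 := by omega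
      simp [qHermite, gaussBinom, oddPochhammer, jacobiOperator_apply_succ]
  | more m ih0 ih1 =>
    have hr : ∀ h, aeval (jacobiOperator (tangentWeight q)) (qHermite q (m + 2))
        (Pi.single 0 1) h = jacobiOperator (tangentWeight q)
          (aeval (jacobiOperator (tangentWeight q)) (qHermite q (m + 1)) (Pi.single 0 1)) h -
        (1 - q ^ (m + 1)) *
          aeval (jacobiOperator (tangentWeight q)) (qHermite q m) (Pi.single 0 1) h := by
      intro h
      rw [qHermite, map_sub, map_mul, map_mul, aeval_X, aeval_C]
      simp only [LinearMap.sub_apply, Module.End.mul_apply, Module.algebraMap_end_apply,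
        Pi.sub_apply, Pi.smul_apply, smul_eq_mul]
    constructor
    · intro h hh
      obtain ⟨h, rfl⟩ : ∃ i, h = i + 1 := ⟨h - 1, by omega⟩
      rw [hr, jacobiOperator_apply_succ, ih1.1 _ (by omega), ih1.1 _ (by omega),
        ih0.1 _ (by omega)]
      ring
    · intro h j hj
      rw [hr]
      -- At height 0 there is no lower neighbour; the corresponding term of the recurrence carries a
      -- zero Gaussian binomial.
      cases h with
      | zero =>
        obtain ⟨j, rfl⟩ : ∃ i, j = i + 1 := ⟨j - 1, by omega⟩
        obtain rfl : m = 2 * j := by omega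
        rw [jacobiOperator_apply_zero, ih1.2 1 j (by omega), ih0.2 0 j (by omega),
          oddPochhammer_tangent_rec q _ j le_rfl, gaussBinom_eq_zero q (show 2 * j + 1 < 2 * (j + 1) by omega),
          Nat.sub_self, tangentWeight]
        ring
      | succ h =>
        rw [jacobiOperator_apply_succ, ih1.2 h j (by omega)]
        cases j with
        | zero =>
          rw [ih1.1 _ (by omega), ih0.1 _ (by omega)]
          simp [gaussBinom_zero_right]
        | succ j =>
          obtain rfl : m = h + 1 + 2 * j := by omega
          rw [ih1.2 (h + 2) j (by omega), ih0.2 (h + 1) j (by omega),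
            oddPochhammer_tangent_rec q _ j (by omega), Nat.add_sub_cancel, tangentWeight]

/-- The functional `f ↦ (1 - q) Λ (f / X)` on odd polynomials, where `Λ` is the moment functional
of the Jacobi operator. -/
noncomputable def oddMomentFunctional : K[X] →ₗ[K] K where
  -- `divX` drops the constant term, which is zero for odd polynomials, so division by X becomes
  -- linear on all of K[X].
  toFun f := (1 - q) * aeval (jacobiOperator (tangentWeight q)) f.divX (Pi.single 0 1) 0
  map_add' f g := by simp [divX_add, mul_add]
  map_smul' a f := by
    simp only [smul_eq_C_mul, divX_C_mul, map_mul, aeval_C, RingHom.id_apply, smul_eq_mul,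
      Module.End.mul_apply, Module.algebraMap_end_apply, Pi.smul_apply]
    ring

theorem oddMomentFunctional_X_mul (f : K[X]) :
    oddMomentFunctional q (X * f) =
      (1 - q) * aeval (jacobiOperator (tangentWeight q)) f (Pi.single 0 1) 0 := by
  have h : (X * f).divX = f := by ext; simp [coeff_divX]
  simp [oddMomentFunctional, h]

theorem oddMomentFunctional_C_mul (a : K) (f : K[X]) :
    oddMomentFunctional q (C a * f) = a * oddMomentFunctional q f := by
  rw [← smul_eq_C_mul, map_smul, smul_eq_mul]

theorem oddMomentFunctional_qHermite (k : ℕ) :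
    oddMomentFunctional q (qHermite q (2 * k + 1)) = (-1) ^ k * oddPochhammer q (k + 1) := by
  induction k with
  | zero =>
    have h := oddMomentFunctional_X_mul q 1
    simpa [qHermite, oddPochhammer] using h
  | succ k ih =>
    rw [show 2 * (k + 1) + 1 = 2 * k + 1 + 2 by ring, qHermite, map_sub, oddMomentFunctional_X_mul,
      oddMomentFunctional_C_mul, ih,
      (aeval_jacobiOperator_qHermite q (2 * k + 1 + 1)).2 0 (k + 1) (by omega),
      show 2 * (k + 1) = 2 * k + 1 + 1 by ring, gaussBinom_self, oddPochhammer_succ q (k + 1)]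
    ring

/-- The odd moment functional on the Chebyshev polynomials of odd degree. -/
theorem oddMomentFunctional_S (m : ℕ) :
    oddMomentFunctional q (Chebyshev.S K (2 * (m : ℤ) - 1)) = alternatingTheta q m := by
  induction m using Nat.strong_induction_on with
  | _ m ih =>
    cases m with
    | zero => simp [alternatingTheta_zero]
    | succ k =>
      have h1 := oddMomentFunctional_qHermite q k
      rw [qHermite_odd_eq_sum, map_sum, ← sum_gaussBinom_mul_alternatingTheta,
        Finset.sum_range_succ', Finset.sum_range_succ'] at h1
      have h2 : ∀ j ∈ Finset.range k,
          oddMomentFunctional q (C (gaussBinom q (2 * k + 1) (j + 1)) *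
            (Chebyshev.S K (2 * ((k - (j + 1) + 1 : ℕ) : ℤ) - 1) -
              Chebyshev.S K (2 * ((k - (j + 1) : ℕ) : ℤ) - 1))) =
          gaussBinom q (2 * k + 1) (j + 1) *
            (alternatingTheta q (k - (j + 1) + 1) - alternatingTheta q (k - (j + 1))) := by
        intro j hj
        have := Finset.mem_range.mp hj
        rw [oddMomentFunctional_C_mul, map_sub, ih _ (by omega), ih _ (by omega)]
      -- The terms with j ≥ 1 agree by induction; the j = 0 term has coefficient 1 and isolates the
      -- new value.
      rw [Finset.sum_congr rfl h2, add_right_inj, oddMomentFunctional_C_mul, map_sub,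
        gaussBinom_zero_right, one_mul, one_mul, Nat.sub_zero, ih k k.lt_succ_self] at h1
      exact sub_left_inj.mp h1

/-- The moments in terms of the alternating theta sums. -/
theorem one_sub_mul_moment (n : ℕ) :
    (1 - q) * (jacobiOperator (tangentWeight q) ^ (2 * n)) (Pi.single 0 1) 0 =
      ∑ j ∈ Finset.range (n + 1), ((2 * n + 1).choose j : K) *
        (alternatingTheta q (n - j + 1) - alternatingTheta q (n - j)) := by
  have h := oddMomentFunctional_X_mul q (X ^ (2 * n))
  rw [map_pow, aeval_X] at h
  -- Only the Hermite parameter is set to 1; the functional keeps q.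
  rw [← h, ← pow_succ', ← qHermite_one_eq_X_pow, qHermite_odd_eq_sum, map_sum]
  refine Finset.sum_congr rfl fun j _ => ?_
  rw [oddMomentFunctional_C_mul, map_sub, oddMomentFunctional_S, oddMomentFunctional_S,
    gaussBinom_one]

end Hermite

/-- Summation by parts for the ballot-type differences of binomial coefficients. -/
theorem sum_choose_mul_sub {K : Type*} [Field K] (m n : ℕ) (t : ℕ → K) (ht : t 0 = 0) :
    ∑ j ∈ Finset.range (n + 1), (m.choose j : K) * (t (n - j + 1) - t (n - j)) =
      ∑ k ∈ Finset.range (n + 1),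
        ((binomInt m ((n : ℤ) - k) - binomInt m ((n : ℤ) - k - 1) : ℤ) : K) * t (k + 1) := by
  let g : ℕ → K := fun k => (binomInt m ((n : ℤ) - k) : K) * t k
  -- Both boundary terms vanish: t 0 = 0 below, lower index -1 above.
  have hg : ∑ k ∈ Finset.range (n + 1), (g (k + 1) - g k) = 0 := by
    rw [Finset.sum_range_sub]
    simp [g, ht, binomInt]
  rw [← Finset.sum_range_reflect, ← sub_eq_zero, ← hg, ← Finset.sum_sub_distrib]
  refine Finset.sum_congr rfl fun k hk => ?_
  have hk : k ≤ n := Nat.lt_succ_iff.mp (Finset.mem_range.mp hk)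
  have hb : binomInt m ((n : ℤ) - k) = m.choose (n - k) := by
    rw [binomInt, if_pos (by omega), show ((n : ℤ) - k).toNat = n - k by omega]
  simp only [g]
  rw [show (n : ℤ) - ((k + 1 : ℕ) : ℤ) = n - k - 1 by push_cast; ring, hb,
    show n + 1 - 1 - k = n - k by omega, show n - (n - k) = k by omega]
  push_cast
  ring

theorem qTangentNumber_eq_moment {K : Type*} [Field K] (q : K) (n : ℕ) :
    qTangentNumber q n =
      (1 / (1 - q) ^ 2) ^ n * (jacobiOperator (tangentWeight q) ^ (2 * n)) (Pi.single 0 1) 0 := by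
  rw [← coeff_stieltjesFraction_smul, qTangentNumber]
  congr 2
  funext h
  rw [qInteger, qInteger, tangentWeight, div_mul_div_comm, ← sq, one_div, div_eq_inv_mul]

theorem theorem3 {K : Type*} [Field K] (q : K) (hq : q ≠ 1) (n : ℕ) :
    qTangentNumber q n =
      1 / (1 - q) ^ (2 * n + 1) *
        ∑ k ∈ Finset.range (n + 1),
          ((binomInt (2 * n + 1) ((n : ℤ) - k) - binomInt (2 * n + 1) ((n : ℤ) - k - 1) : ℤ) : K) *
            ∑ i ∈ Finset.range (2 * k + 2),
              (-1 : K) ^ (i + k) * q ^ (i * (2 * k + 2 - i)) := by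
  have h1q : (1 - q) ≠ 0 := sub_ne_zero.mpr (Ne.symm hq)
  have h := one_sub_mul_moment q n
  rw [sum_choose_mul_sub _ _ _ (alternatingTheta_zero q)] at h
  have ht : ∀ k, alternatingTheta q (k + 1) = ∑ i ∈ Finset.range (2 * k + 2),
      (-1 : K) ^ (i + k) * q ^ (i * (2 * k + 2 - i)) := fun k =>
    Finset.sum_congr rfl fun i _ => by
      rw [show i + (k + 1) + 1 = i + k + 2 by ring, pow_add _ (i + k), mul_add]
      simp
  simp only [ht] at h
  rw [← h, qTangentNumber_eq_moment]
  generalize (jacobiOperator (tangentWeight q) ^ (2 * n)) (Pi.single 0 1) 0 = M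
  rw [pow_succ _ (2 * n), pow_mul, div_pow, one_pow]
  field_simp
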